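/- **SI is GI-hard.** An *item* over a finite domain $D$ is a subset of $D$, and an *itemset* over $D$ is a set of items. For a bijection $J : D \to D$ and an itemset $S$ over $D$ put $J(S) = \{\{J(d) \mid d \in I\} \mid I \in S\}$. *Subitemset Isomorphism* (SI) is the decision problem whose input is two itemsets $S$ and $T$ over the same finite domain $D$ (given by the size of $D$ in unary, and by their $|S| \times |D|$ and $|T| \times |D|$ zero-one matrices, with one row for each item), and whose question is whether there is a bijection $J : D \to D$ with $J(S) \subseteq T$. *Graph Isomorphism* (GI) is the decision problem whose input is two finite undirected (simple) graphs $G = \langle V_G, E_G\rangle$ and $H = \langle V_H, E_H\rangle$ (given by their adjacency matrices), and whose question is whether there is a bijection $I : V_G \to V_H$ such that $\{v,w\} \in E_G$ if and only if $\{I(v), I(w)\} \in E_H$, for all $v, w \in V_G$. Then SI is GI-hard, that is, GI $\le_P$ SI: there is a function $f$, computable by a Turing machine in time polynomial in the length of the input, that maps every instance of GI to an instance of SI, such that $\langle G, H\rangle$ is a yes-instance of GI if and only if $f(\langle G, H\rangle)$ is a yes-instance of SI. -/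

import Mathlib

/-! ### Decision problems and polynomial-time many-one reductions -/

/-- A decision problem: a type of instances, an unambiguous encoding of the instances as words over
a finite alphabet, and the set of yes-instances. -/
structure DecisionProblem where
  /-- the instances -/
  Inst : Type
  /-- the alphabet -/
  Alphabet : Type
  /-- the alphabet is finite -/
  alphabet_finite : Finite Alphabet
  /-- the word that presents an instance to a machine -/
  encode : Inst → List Alphabet
  /-- an instance can be recovered from its encoding -/
  encode_injective : Function.Injective encode
  /-- the yes-instances -/
  Yes : Inst → Prop

/-- `f` is computed, between encoded instances, by a (multi-stack) Turing machine whose number of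
steps is bounded by a polynomial in the length of the input word.  All stack alphabets of the
machine are required to be finite. -/
def PolyTimeComputable (P Q : DecisionProblem) (f : P.Inst → Q.Inst) : Prop :=
  ∃ M : Turing.TM2ComputableInPolyTime P.encode Q.encode f, ∀ k, Finite (M.tm.Γ k)

/-- Polynomial-time many-one (Karp) reducibility `P ≤_P Q`. -/
def PolyTimeReducible (P Q : DecisionProblem) : Prop :=
  ∃ f : P.Inst → Q.Inst, PolyTimeComputable P Q f ∧ ∀ x, P.Yes x ↔ Q.Yes (f x)

/-! ### Writing zero-one matrices as words -/

/-- The alphabet of the encodings: the two bits, a mark `rowEnd` that closes a row of a matrix,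
and a mark `blockEnd` that closes a block of the input. -/
inductive Letter
  | zero
  | one
  | rowEnd
  | blockEnd
  deriving DecidableEq

instance : Fintype Letter where
  elems := {Letter.zero, Letter.one, Letter.rowEnd, Letter.blockEnd}
  complete x := by cases x <;> simp

/-- The letter for a bit. -/
def bitLetter (b : Bool) : Letter := bif b then Letter.one else Letter.zero

/-- A zero-one matrix, given as the list of its rows, written row by row. -/
def encodeMatrix (L : List (List Bool)) : List Letter :=
  (L.flatMap fun r => r.map bitLetter ++ [Letter.rowEnd]) ++ [Letter.blockEnd]

/-- A natural number in unary. -/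
def encodeUnary (n : ℕ) : List Letter :=
  List.replicate n Letter.one ++ [Letter.blockEnd]

/-! ### Graph isomorphism -/

/-- The rows of the adjacency matrix of a graph with vertices `0, …, n - 1`. -/
noncomputable def adjacencyRows {n : ℕ} (G : SimpleGraph (Fin n)) : List (List Bool) :=
  open Classical in
  List.ofFn fun i => List.ofFn fun j => decide (G.Adj i j)

/-- An instance of graph isomorphism: two finite undirected graphs, whose vertices are numbered. -/
structure GIInstance where
  /-- number of vertices of the first graph -/
  m : ℕ
  /-- number of vertices of the second graph -/
  n : ℕ
  /-- the first graph -/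
  G : SimpleGraph (Fin m)
  /-- the second graph -/
  H : SimpleGraph (Fin n)

/-- The two adjacency matrices, one after the other. -/
noncomputable def GIInstance.encode (x : GIInstance) : List Letter :=
  encodeMatrix (adjacencyRows x.G) ++ encodeMatrix (adjacencyRows x.H)

/-- There is a bijection of the vertex sets that preserves adjacency in both directions. -/
def GIInstance.Yes (x : GIInstance) : Prop :=
  ∃ I : Fin x.m ≃ Fin x.n, ∀ v w, x.G.Adj v w ↔ x.H.Adj (I v) (I w)

/-! ### Subitemset isomorphism -/

/-- An item over the domain `{0, …, n - 1}`: a subset of the domain. -/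
abbrev Item (n : ℕ) : Type := Finset (Fin n)

/-- An itemset over the domain `{0, …, n - 1}`: a set of items. -/
abbrev Itemset (n : ℕ) : Type := Finset (Item n)

/-- The itemset `J(S) = {{J(d) | d ∈ I} | I ∈ S}`. -/
def Itemset.map {n : ℕ} (J : Fin n ≃ Fin n) (S : Itemset n) : Itemset n :=
  S.image fun I => I.image J

/-- An itemset as it is written down: its items, listed without repetition in some order. -/
structure ItemsetListing (n : ℕ) where
  /-- the listed items -/
  items : List (Item n)
  /-- no item is listed twice -/
  nodup : items.Nodup

/-- The itemset that is listed. -/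
def ItemsetListing.toItemset {n : ℕ} (S : ItemsetListing n) : Itemset n :=
  S.items.toFinset

/-- The rows of the zero-one matrix of a listed itemset: one row for each item, with a `1` in
column `d` iff `d` belongs to the item. -/
def ItemsetListing.matrixRows {n : ℕ} (S : ItemsetListing n) : List (List Bool) :=
  S.items.map fun I => List.ofFn fun d => decide (d ∈ I)

/-- An instance of subitemset isomorphism: two itemsets over the same finite domain. -/
structure SIInstance where
  /-- size of the domain -/
  n : ℕ
  /-- the first itemset -/
  S : ItemsetListing n
  /-- the second itemset -/
  T : ItemsetListing n

/-- The size of the domain in unary and the matrices of the two itemsets. -/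
def SIInstance.encode (x : SIInstance) : List Letter :=
  encodeUnary x.n ++ encodeMatrix x.S.matrixRows ++ encodeMatrix x.T.matrixRows

/-- There is a bijection `J` of the domain with `J(S) ⊆ T`. -/
def SIInstance.Yes (x : SIInstance) : Prop :=
  ∃ J : Fin x.n ≃ Fin x.n, x.S.toItemset.map J ⊆ x.T.toItemset

/-! ### The encodings are unambiguous -/

theorem encodeRow_cancel : ∀ {r s : List Bool} {u v : List Letter},
    r.map bitLetter ++ Letter.rowEnd :: u = s.map bitLetter ++ Letter.rowEnd :: v →
      r = s ∧ u = v
  | [], [], _, _, h => by simpa using h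
  | [], b :: s, _, _, h => by cases b <;> simp [bitLetter] at h
  | b :: r, [], _, _, h => by cases b <;> simp [bitLetter] at h
  | b :: r, c :: s, u, v, h => by
    simp only [List.map_cons, List.cons_append, List.cons.injEq] at h
    have hbc : b = c := by
      have := h.1
      cases b <;> cases c <;> simp_all [bitLetter]
    obtain ⟨h1, h2⟩ := encodeRow_cancel h.2
    exact ⟨by rw [hbc, h1], h2⟩

theorem encodeMatrix_cons (r : List Bool) (L : List (List Bool)) (u : List Letter) :
    encodeMatrix (r :: L) ++ u = r.map bitLetter ++ Letter.rowEnd :: (encodeMatrix L ++ u) := by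
  simp [encodeMatrix]

theorem blockEnd_ne_encodeMatrix_cons {r : List Bool} {L : List (List Bool)}
    {u v : List Letter} : Letter.blockEnd :: u ≠ encodeMatrix (r :: L) ++ v := by
  intro h
  rw [encodeMatrix_cons] at h
  rcases r with _ | ⟨b, r⟩
  · simp at h
  · cases b <;> simp [bitLetter] at h

theorem encodeMatrix_cancel : ∀ {L M : List (List Bool)} {u v : List Letter},
    encodeMatrix L ++ u = encodeMatrix M ++ v → L = M ∧ u = v
  | [], [], _, _, h => by simpa [encodeMatrix] using h
  | [], _ :: _, _, _, h => (blockEnd_ne_encodeMatrix_cons (by simpa [encodeMatrix] using h)).elim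
  | _ :: _, [], _, _, h =>
    (blockEnd_ne_encodeMatrix_cons (by simpa [encodeMatrix] using h.symm)).elim
  | r :: L, s :: M, u, v, h => by
    rw [encodeMatrix_cons, encodeMatrix_cons] at h
    obtain ⟨h1, h2⟩ := encodeRow_cancel h
    obtain ⟨h3, h4⟩ := encodeMatrix_cancel h2
    exact ⟨by rw [h1, h3], h4⟩

theorem encodeUnary_cancel : ∀ {m n : ℕ} {u v : List Letter},
    encodeUnary m ++ u = encodeUnary n ++ v → m = n ∧ u = v
  | 0, 0, _, _, h => by simpa [encodeUnary] using h
  | 0, _ + 1, _, _, h => by simp [encodeUnary, List.replicate_succ] at h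
  | _ + 1, 0, _, _, h => by simp [encodeUnary, List.replicate_succ] at h
  | m + 1, n + 1, u, v, h => by
    have h' : encodeUnary m ++ u = encodeUnary n ++ v := by
      simpa [encodeUnary, List.replicate_succ] using h
    obtain ⟨h1, h2⟩ := encodeUnary_cancel h'
    exact ⟨by rw [h1], h2⟩

theorem adjacencyRows_length {n : ℕ} (G : SimpleGraph (Fin n)) :
    (adjacencyRows G).length = n := by
  simp [adjacencyRows]

theorem adjacencyRows_injective {n : ℕ} :
    Function.Injective (adjacencyRows : SimpleGraph (Fin n) → List (List Bool)) := by
  intro G H h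
  ext i j
  have h1 := congrFun (List.ofFn_injective h) i
  have h2 := congrFun (List.ofFn_injective h1) j
  simpa using h2

theorem GIInstance.encode_injective : Function.Injective GIInstance.encode := by
  rintro ⟨m, n, G, H⟩ ⟨m', n', G', H'⟩ h
  obtain ⟨h1, h2⟩ := encodeMatrix_cancel h
  have h3 := (encodeMatrix_cancel (u := []) (v := []) (by simpa using h2)).1
  obtain rfl : m = m' := by
    rw [← adjacencyRows_length G, ← adjacencyRows_length G']
    exact congrArg List.length h1
  obtain rfl : n = n' := by
    rw [← adjacencyRows_length H, ← adjacencyRows_length H']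
    exact congrArg List.length h3
  obtain rfl : G = G' := adjacencyRows_injective h1
  obtain rfl : H = H' := adjacencyRows_injective h3
  rfl

theorem ItemsetListing.matrixRows_injective {n : ℕ} :
    Function.Injective (ItemsetListing.matrixRows : ItemsetListing n → List (List Bool)) := by
  rintro ⟨S, hS⟩ ⟨T, hT⟩ h
  have hinj : Function.Injective
      (fun I : Item n => List.ofFn fun d => decide (d ∈ I)) := by
    intro I I' hI
    ext d
    have := congrFun (List.ofFn_injective hI) d
    simpa using this
  obtain rfl : S = T := List.map_injective_iff.2 hinj h
  rfl

theorem SIInstance.encode_injective : Function.Injective SIInstance.encode := by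
  rintro ⟨n, S, T⟩ ⟨n', S', T'⟩ h
  simp only [SIInstance.encode, List.append_assoc] at h
  obtain ⟨h0, h1⟩ := encodeUnary_cancel h
  subst h0
  obtain ⟨h2, h3⟩ := encodeMatrix_cancel h1
  have h4 := (encodeMatrix_cancel (u := []) (v := []) (by simpa using h3)).1
  obtain rfl : S = S' := ItemsetListing.matrixRows_injective h2
  obtain rfl : T = T' := ItemsetListing.matrixRows_injective h4
  rfl

/-! ### The two problems, and hardness for graph isomorphism -/

/-- The graph isomorphism problem. -/
noncomputable def graphIsomorphism : DecisionProblem where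
  Inst := GIInstance
  Alphabet := Letter
  alphabet_finite := inferInstance
  encode := GIInstance.encode
  encode_injective := GIInstance.encode_injective
  Yes := GIInstance.Yes

/-- The subitemset isomorphism problem. -/
def subitemsetIsomorphism : DecisionProblem where
  Inst := SIInstance
  Alphabet := Letter
  alphabet_finite := inferInstance
  encode := SIInstance.encode
  encode_injective := SIInstance.encode_injective
  Yes := SIInstance.Yes

/-- A problem is GI-hard if graph isomorphism reduces to it in polynomial time. -/
def GIHard (P : DecisionProblem) : Prop :=
  PolyTimeReducible graphIsomorphism P

/-! A graph on n vertices becomes an itemset over 2n + 2 points: columns a_i, b_i for each vertex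
and two extra columns e, e'. Vertex i contributes {a_i}, {a_i, b_i} and {a_i, e, e'} ∪ {b_j | j
adjacent to i}. These have size 1, 2 and at least 3, so a bijection J that maps one such itemset
into another respects the three kinds. The singletons force J(a_i) = a_{I(i)} for some injective I,
the pairs force J(b_i) = b_{I(i)}, and the large items then say that I preserves adjacency in both
directions. Conversely, an isomorphism acts on the columns and fixes e, e'. This is
`exists_map_vertexListing_subset_iff`; graphs of different orders go to a fixed no-instance.

The reduction is computed by an explicit stack machine. Its output is a stack, so the word is built
from its end: the matrix read last lies on top and becomes the first itemset, and the items appear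
in reverse order. A unary count of the rows read so far locates the diagonal entry of the current
row (`runs_bits`, `runs_row`). Finally the two row counts are popped in parallel: if they agree the
unary domain size is written (`runs_compare_eq`), otherwise the output is erased and replaced
(`runs_compare_ne`). The number of steps is linear in the input length (`runs_machine`). -/

/-! ### Three items for each vertex -/

/-- The domain consists of two columns for each vertex and two extra columns. -/
def columnEquiv (n : ℕ) : (Fin n × Fin 2) ⊕ Fin 2 ≃ Fin (n * 2 + 2) :=
  (Equiv.sumCongr finProdFinEquiv (Equiv.refl _)).trans finSumFinEquiv

/-- The item whose row carries `u j` and `v j` in the columns of the vertex `j`, and `f` in the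
extra columns. -/
def columnItem {n : ℕ} (u v : Fin n → Bool) (f : Bool) : Item (n * 2 + 2) :=
  Finset.univ.filter fun d =>
    Sum.elim (fun p => if p.2 = 0 then u p.1 else v p.1) (fun _ => f) ((columnEquiv n).symm d) = true

theorem columnEquiv_inl_mem {n : ℕ} {u v : Fin n → Bool} {f : Bool} (p : Fin n × Fin 2) :
    columnEquiv n (Sum.inl p) ∈ columnItem u v f ↔ (if p.2 = 0 then u p.1 else v p.1) = true := by
  simp [columnItem]

theorem columnEquiv_inr_mem {n : ℕ} {u v : Fin n → Bool} {f : Bool} (s : Fin 2) :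
    columnEquiv n (Sum.inr s) ∈ columnItem u v f ↔ f = true := by
  simp [columnItem]

/-- The two columns of a vertex are adjacent in the numbering, so a machine can emit them while
reading one matrix entry. -/
theorem ofFn_mem_columnItem {n : ℕ} (u v : Fin n → Bool) (f : Bool) :
    (List.ofFn fun d => decide (d ∈ columnItem u v f)) =
      (List.ofFn fun j => [u j, v j]).flatten ++ [f, f] := by
  have hl : ∀ (i : Fin n) (s : Fin 2) (h : i.val * 2 + s.val < n * 2),
      Fin.castLE (Nat.le_add_right _ 2) (⟨i.val * 2 + s.val, h⟩ : Fin (n * 2)) = columnEquiv n (Sum.inl (i, s)) := by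
    intro i s h
    ext
    simp [columnEquiv, finProdFinEquiv]
    ring
  have hr : ∀ s : Fin 2, Fin.natAdd (n * 2) s = columnEquiv n (Sum.inr s) := by
    intro s
    simp [columnEquiv]
  rw [List.ofFn_add, List.ofFn_mul]
  simp only [hl, hr, columnEquiv_inl_mem, columnEquiv_inr_mem]
  simp

open Classical in
/-- The items of a vertex: its first column, its two columns, and its first column together with
the second columns of its neighbours and the extra columns. -/
noncomputable def vertexItem {n : ℕ} (G : SimpleGraph (Fin n)) (i : Fin n) (t : Fin 3) :
    Item (n * 2 + 2) :=
  columnItem (fun j => decide (j = i))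
    (fun j => match t with
      | 0 => false
      | 1 => decide (j = i)
      | 2 => decide (G.Adj i j))
    (decide (t = 2))

theorem vertexItem_first_mem {n : ℕ} {G : SimpleGraph (Fin n)} {i j : Fin n} {t : Fin 3} :
    columnEquiv n (Sum.inl (j, 0)) ∈ vertexItem G i t ↔ j = i := by
  simp [vertexItem, columnEquiv_inl_mem]

theorem vertexItem_second_mem {n : ℕ} {G : SimpleGraph (Fin n)} {i j : Fin n} :
    columnEquiv n (Sum.inl (j, 1)) ∈ vertexItem G i 2 ↔ G.Adj i j := by
  simp [vertexItem, columnEquiv_inl_mem]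

theorem vertexItem_zero {n : ℕ} (G : SimpleGraph (Fin n)) (i : Fin n) :
    vertexItem G i 0 = {columnEquiv n (Sum.inl (i, 0))} := by
  ext d
  obtain ⟨x, rfl⟩ := (columnEquiv n).surjective d
  rcases x with ⟨j, s⟩ | s
  · fin_cases s <;> simp [vertexItem, columnEquiv_inl_mem]
  · simp [vertexItem, columnEquiv_inr_mem]

theorem vertexItem_one {n : ℕ} (G : SimpleGraph (Fin n)) (i : Fin n) :
    vertexItem G i 1 = {columnEquiv n (Sum.inl (i, 0)), columnEquiv n (Sum.inl (i, 1))} := by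
  ext d
  obtain ⟨x, rfl⟩ := (columnEquiv n).surjective d
  rcases x with ⟨j, s⟩ | s
  · fin_cases s <;> simp [vertexItem, columnEquiv_inl_mem]
  · simp [vertexItem, columnEquiv_inr_mem]

theorem vertexItem_zero_card {n : ℕ} (G : SimpleGraph (Fin n)) (i : Fin n) :
    (vertexItem G i 0).card = 1 := by
  simp [vertexItem_zero]

theorem vertexItem_one_card {n : ℕ} (G : SimpleGraph (Fin n)) (i : Fin n) :
    (vertexItem G i 1).card = 2 := by
  rw [vertexItem_one, Finset.card_pair]
  simp

/-- This is what the two extra columns are for: without them a vertex of degree 0 or 1 would have a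
third item of size 1 or 2. -/
theorem vertexItem_two_card {n : ℕ} (G : SimpleGraph (Fin n)) (i : Fin n) :
    2 < (vertexItem G i 2).card := by
  rw [Finset.two_lt_card]
  refine ⟨columnEquiv n (Sum.inl (i, 0)), vertexItem_first_mem.2 rfl,
    columnEquiv n (Sum.inr 0), ?_, columnEquiv n (Sum.inr 1), ?_, by simp, by simp, by simp⟩ <;>
  simp [vertexItem, columnEquiv_inr_mem]

/-- The size of an item of a vertex tells its kind. -/
theorem vertexItem_kind_eq {n : ℕ} {G H : SimpleGraph (Fin n)} {i k : Fin n} {s t : Fin 3}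
    (h : (vertexItem G i s).card = (vertexItem H k t).card) : s = t := by
  have h0 := vertexItem_zero_card G i
  have h1 := vertexItem_one_card G i
  have h2 := vertexItem_two_card G i
  have k0 := vertexItem_zero_card H k
  have k1 := vertexItem_one_card H k
  have k2 := vertexItem_two_card H k
  fin_cases s <;> fin_cases t <;> simp only [Fin.zero_eta, Fin.mk_one, Fin.reduceFinMk] at * <;>
    first | rfl | omega

/-- The list of the items of all vertices. -/
noncomputable def vertexListing {n : ℕ} (G : SimpleGraph (Fin n)) : ItemsetListing (n * 2 + 2) where
  -- Reversed because rows pushed later lie higher on the output stack.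
  items := ((List.finRange n).flatMap fun i => (List.finRange 3).map (vertexItem G i)).reverse
  nodup := by
    rw [List.nodup_reverse, List.nodup_flatMap]
    refine ⟨fun i _ => (List.nodup_finRange 3).map fun s t h =>
      vertexItem_kind_eq (G := G) (H := G) (i := i) (k := i) (congrArg Finset.card h),
      (List.nodup_finRange n).imp ?_⟩
    intro i j hij I hi hj
    obtain ⟨s, -, rfl⟩ := List.mem_map.1 hi
    obtain ⟨t, -, h⟩ := List.mem_map.1 hj
    -- The only first column in an item is that of its own vertex, so the item determines the
    -- vertex.
    have hmem : columnEquiv n (Sum.inl (i, 0)) ∈ vertexItem G i s := vertexItem_first_mem.2 rfl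
    rw [← h, vertexItem_first_mem] at hmem
    exact hij hmem

theorem mem_vertexListing {n : ℕ} {G : SimpleGraph (Fin n)} {I : Item (n * 2 + 2)} :
    I ∈ (vertexListing G).toItemset ↔ ∃ i t, vertexItem G i t = I := by
  simp [vertexListing, ItemsetListing.toItemset]

/-! ### Correctness of the reduction -/

/-- Graphs are isomorphic iff the itemset of the first can be mapped into that of the second. -/
theorem exists_map_vertexListing_subset_iff {n : ℕ} (G H : SimpleGraph (Fin n)) :
    (∃ J : Fin (n * 2 + 2) ≃ Fin (n * 2 + 2),
      (vertexListing G).toItemset.map J ⊆ (vertexListing H).toItemset) ↔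
    ∃ I : Fin n ≃ Fin n, ∀ v w, G.Adj v w ↔ H.Adj (I v) (I w) := by
  constructor
  · rintro ⟨J, hJ⟩
    have key : ∀ i t, ∃ k, (vertexItem G i t).image J = vertexItem H k t := by
      intro i t
      have hmem := hJ (Finset.mem_image_of_mem _ (mem_vertexListing.2 ⟨i, t, rfl⟩))
      obtain ⟨k, s, hk⟩ := mem_vertexListing.1 hmem
      have hcard := congrArg Finset.card hk
      rw [Finset.card_image_of_injective _ J.injective] at hcard
      exact ⟨k, by rw [← hk, vertexItem_kind_eq hcard]⟩
    have h0 : ∀ i, ∃ k, J (columnEquiv n (Sum.inl (i, 0))) = columnEquiv n (Sum.inl (k, 0)) := by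
      intro i
      obtain ⟨k, hk⟩ := key i 0
      rw [vertexItem_zero, vertexItem_zero, Finset.image_singleton, Finset.singleton_inj] at hk
      exact ⟨k, hk⟩
    choose I hI using h0
    have hinj : Function.Injective I := by
      intro i j hij
      have := (hI i).trans ((congrArg (fun k => columnEquiv n (Sum.inl (k, 0))) hij).trans
        (hI j).symm)
      simpa using this
    have hkey : ∀ i t, (vertexItem G i t).image J = vertexItem H (I i) t := by
      intro i t
      obtain ⟨k, hk⟩ := key i t
      -- All three items of `i` contain its first column, whose image is already known; this
      -- identifies `k` with `I i`.
      have hmem : J (columnEquiv n (Sum.inl (i, 0))) ∈ (vertexItem G i t).image J :=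
        Finset.mem_image_of_mem _ (vertexItem_first_mem.2 rfl)
      rw [hk, hI, vertexItem_first_mem] at hmem
      rw [hk, hmem]
    have h1 : ∀ i, J (columnEquiv n (Sum.inl (i, 1))) = columnEquiv n (Sum.inl (I i, 1)) := by
      intro i
      have hmem : J (columnEquiv n (Sum.inl (i, 1))) ∈ (vertexItem G i 1).image J :=
        Finset.mem_image_of_mem _ (by simp [vertexItem_one])
      -- Of the two points of the image pair, the first is already taken by the first column of `i`.
      rw [hkey, vertexItem_one, Finset.mem_insert, Finset.mem_singleton, ← hI] at hmem
      rcases hmem with h | h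
      · simp at h
      · exact h
    refine ⟨Equiv.ofBijective I (Finite.injective_iff_bijective.1 hinj), fun v w => ?_⟩
    rw [Equiv.ofBijective_apply, Equiv.ofBijective_apply,
      ← vertexItem_second_mem (G := H), ← hkey, ← h1,
      Function.Injective.mem_finset_image J.injective, vertexItem_second_mem]
  · rintro ⟨I, hI⟩
    let J := ((columnEquiv n).symm.trans
      (Equiv.sumCongr (Equiv.prodCongr I (Equiv.refl _)) (Equiv.refl _))).trans (columnEquiv n)
    refine ⟨J, fun A hA => ?_⟩
    obtain ⟨B, hB, rfl⟩ := Finset.mem_image.1 hA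
    obtain ⟨i, t, rfl⟩ := mem_vertexListing.1 hB
    refine mem_vertexListing.2 ⟨I i, t, ?_⟩
    ext d
    obtain ⟨d, rfl⟩ := J.surjective d
    obtain ⟨x, rfl⟩ := (columnEquiv n).surjective d
    rw [Function.Injective.mem_finset_image J.injective]
    rcases x with ⟨j, s⟩ | s
    · have : J (columnEquiv n (Sum.inl (j, s))) = columnEquiv n (Sum.inl (I j, s)) := by simp [J]
      rw [this]
      fin_cases t <;> simp [vertexItem, columnEquiv_inl_mem, ← hI]
    · have : J (columnEquiv n (Sum.inr s)) = columnEquiv n (Sum.inr s) := by simp [J]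
      rw [this]
      simp [vertexItem, columnEquiv_inr_mem]

/-- The reduction. Graphs of different orders are sent to an instance without solutions. -/
noncomputable def graphToItemsets : GIInstance → SIInstance
  | ⟨m, n, G, H⟩ =>
    if h : n = m then ⟨m * 2 + 2, vertexListing (h ▸ H), vertexListing G⟩
    else ⟨0, ⟨[∅], List.nodup_singleton _⟩, ⟨[], List.nodup_nil⟩⟩

theorem graphToItemsets_yes_iff (x : GIInstance) : x.Yes ↔ (graphToItemsets x).Yes := by
  obtain ⟨m, n, G, H⟩ := x
  by_cases h : n = m
  · subst h
    simp only [graphToItemsets, dif_pos]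
    -- The itemset of `H` comes first in the instance, so the isomorphism is inverted.
    refine Iff.trans ?_ (exists_map_vertexListing_subset_iff H G).symm
    constructor
    · rintro ⟨I, hI⟩
      exact ⟨I.symm, fun v w => by simpa using (hI (I.symm v) (I.symm w)).symm⟩
    · rintro ⟨I, hI⟩
      exact ⟨I.symm, fun v w => by simpa using (hI (I.symm v) (I.symm w)).symm⟩
  · simp only [graphToItemsets, dif_neg h]
    constructor
    · rintro ⟨I, -⟩
      exact (h (by simpa using (Fintype.card_congr I).symm)).elim
    · rintro ⟨J, hJ⟩
      have := @hJ ∅ (by simp [Itemset.map, ItemsetListing.toItemset])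
      simp [ItemsetListing.toItemset] at this

/-! ### Runs of bounded length -/

/-- The iteration of the partial function `f` leads from `a` to `b` in at most `t` steps. -/
def ReachesWithin {α : Type*} (f : α → Option α) (a b : α) (t : ℕ) : Prop :=
  ∃ k ≤ t, (flip bind f)^[k] (some a) = some b

namespace ReachesWithin

variable {α : Type*} {f : α → Option α} {a b c : α} {s t : ℕ}

theorem refl (a : α) (t : ℕ) : ReachesWithin f a a t := ⟨0, Nat.zero_le _, rfl⟩

theorem trans (h₁ : ReachesWithin f a b s) (h₂ : ReachesWithin f b c t) :
    ReachesWithin f a c (s + t) := by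
  obtain ⟨k, hk, h₁⟩ := h₁
  obtain ⟨l, hl, h₂⟩ := h₂
  exact ⟨l + k, by omega, by rw [Function.iterate_add_apply, h₁, h₂]⟩

theorem single (h : f a = some b) : ReachesWithin f a b 1 :=
  ⟨1, le_rfl, h⟩

theorem head (h : f a = some b) (h' : ReachesWithin f b c t) : ReachesWithin f a c (t + 1) :=
  add_comm 1 t ▸ (single h).trans h'

theorem mono (h : ReachesWithin f a b s) (hst : s ≤ t) : ReachesWithin f a b t := by
  obtain ⟨k, hk, h⟩ := h
  exact ⟨k, hk.trans hst, h⟩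

end ReachesWithin

/-! ### The machine -/

namespace ItemsetMachine

open Turing Turing.TM2.Stmt Function

/-- The stacks: input, output, the number of rows read in the current block, the part of this
number that was used up in the current row, the number of rows of the block before, and the
columns of the three rows to be written. -/
inductive Stack
  | inp
  | out
  | rows
  | used
  | prev
  | row (t : Fin 3)
  deriving DecidableEq, Fintype

/-- The labels of the program. -/
inductive Label
  | start
  | read
  | rowStart (t : Fin 3)
  | drain (t : Fin 3)
  | back
  | shift
  | compare
  | clear
  deriving DecidableEq, Fintype

/-- The registers: a flag, which in a row tells that the diagonal was passed, and two letters. -/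
abbrev Reg : Type := Bool × Option Letter × Option Letter

/-- The label that follows the writing of a row. -/
def Label.afterDrain : Fin 3 → Label
  | 0 => .rowStart 1
  | 1 => .rowStart 2
  | 2 => .back

/-- The mark for the diagonal. -/
def diagLetter (s : Reg) : Letter := bitLetter (!s.1 && s.2.2.isNone)

/-- The program. -/
def program : Label → TM2.Stmt (fun _ : Stack => Letter) Label Reg
  | .start => push .out (fun _ => .blockEnd) <| goto fun _ => .read
  | .read =>
    pop .inp (fun s x => (s.1, x, none)) <|
    branch (fun s => s.2.1 = some .rowEnd)
      (push .rows (fun _ => .one) <| load (fun _ => (false, none, none)) <|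
        goto fun _ => .rowStart 0) <|
    branch (fun s => s.2.1 = some .blockEnd)
      (push .out (fun _ => .blockEnd) <| peek .inp (fun s x => (s.1, x, none)) <|
        branch (fun s => s.2.1.isNone)
          (load (fun s => (s.1, none, none)) <| goto fun _ => .compare)
          (load (fun s => (s.1, none, none)) <| goto fun _ => .shift)) <|
    -- In row i the counter holds i ones and each bit removes one. The first bit that finds it empty
    -- is the diagonal entry.
    pop .rows (fun s x => (s.1, s.2.1, x)) <|
    push (.row 0) diagLetter <| push (.row 0) (fun _ => .zero) <|
    push (.row 1) diagLetter <| push (.row 1) diagLetter <|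
    push (.row 2) diagLetter <| push (.row 2) (fun s => s.2.1.getD .zero) <|
    branch (fun s => s.2.2.isSome)
      (push .used (fun _ => .one) <| load (fun s => (s.1, none, none)) <| goto fun _ => .read)
      (load (fun _ => (true, none, none)) <| goto fun _ => .read)
  | .rowStart t =>
    push .out (fun _ => .rowEnd) <|
    push .out (fun _ => bitLetter (decide (t = 2))) <|
    push .out (fun _ => bitLetter (decide (t = 2))) <|
    goto fun _ => .drain t
  | .drain t =>
    pop (.row t) (fun s x => (s.1, x, none)) <|
    branch (fun s => s.2.1.isSome)
      (push .out (fun s => s.2.1.getD .zero) <| load (fun s => (s.1, none, none)) <|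
        goto fun _ => .drain t)
      (goto fun _ => Label.afterDrain t)
  | .back =>
    pop .used (fun s x => (s.1, x, none)) <|
    branch (fun s => s.2.1.isSome)
      (push .rows (fun _ => .one) <| load (fun s => (s.1, none, none)) <| goto fun _ => .back)
      (goto fun _ => .read)
  | .shift =>
    pop .rows (fun s x => (s.1, x, none)) <|
    branch (fun s => s.2.1.isSome)
      (push .prev (fun _ => .one) <| load (fun s => (s.1, none, none)) <| goto fun _ => .shift)
      (goto fun _ => .read)
  | .compare =>
    pop .rows (fun s x => (s.1, x, none)) <|
    pop .prev (fun s x => (s.1, s.2.1, x)) <|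
    branch (fun s => s.2.1.isSome && s.2.2.isSome)
      (push .out (fun _ => .one) <| push .out (fun _ => .one) <|
        load (fun s => (s.1, none, none)) <| goto fun _ => .compare) <|
    branch (fun s => s.2.1.isSome || s.2.2.isSome)
      (load (fun s => (s.1, none, none)) <| goto fun _ => .clear)
      (push .out (fun _ => .one) <| push .out (fun _ => .one) <|
        -- A halting configuration must carry the initial register values, so the letters are
        -- cleared.
        load (fun s => (s.1, none, none)) halt)
  | .clear =>
    pop .rows (fun s x => (s.1 || x.isSome, none, none)) <|
    pop .prev (fun s x => (s.1 || x.isSome, none, none)) <|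
    pop .out (fun s x => (s.1 || x.isSome, none, none)) <|
    branch (fun s => s.1)
      (load (fun _ => (false, none, none)) <| goto fun _ => .clear)
      (push .out (fun _ => .blockEnd) <| push .out (fun _ => .blockEnd) <|
        push .out (fun _ => .rowEnd) <| push .out (fun _ => .blockEnd) halt)

/-- The contents of the stacks. -/
def contents (inp out rows used prev : List Letter) (row : Fin 3 → List Letter) :
    Stack → List Letter
  | .inp => inp
  | .out => out
  | .rows => rows
  | .used => used
  | .prev => prev
  | .row t => row t

section

variable (inp out rows used prev x : List Letter) (row : Fin 3 → List Letter) (t : Fin 3)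

@[simp] theorem contents_inp : contents inp out rows used prev row .inp = inp := rfl
@[simp] theorem contents_out : contents inp out rows used prev row .out = out := rfl
@[simp] theorem contents_rows : contents inp out rows used prev row .rows = rows := rfl
@[simp] theorem contents_used : contents inp out rows used prev row .used = used := rfl
@[simp] theorem contents_prev : contents inp out rows used prev row .prev = prev := rfl
@[simp] theorem contents_row : contents inp out rows used prev row (.row t) = row t := rfl

@[simp] theorem update_contents_inp : update (contents inp out rows used prev row) .inp x =
    contents x out rows used prev row := by
  funext k; cases k <;> simp [update]
@[simp] theorem update_contents_out : update (contents inp out rows used prev row) .out x =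
    contents inp x rows used prev row := by
  funext k; cases k <;> simp [update]
@[simp] theorem update_contents_rows : update (contents inp out rows used prev row) .rows x =
    contents inp out x used prev row := by
  funext k; cases k <;> simp [update]
@[simp] theorem update_contents_used : update (contents inp out rows used prev row) .used x =
    contents inp out rows x prev row := by
  funext k; cases k <;> simp [update]
@[simp] theorem update_contents_prev : update (contents inp out rows used prev row) .prev x =
    contents inp out rows used x row := by
  funext k; cases k <;> simp [update]
@[simp] theorem update_contents_row : update (contents inp out rows used prev row) (.row t) x =
    contents inp out rows used prev (update row t x) := by
  funext k; cases k <;> simp [update]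

end

/-- The configuration with given flag and stacks in which the letter registers are empty. -/
def config (l : Option Label) (flag : Bool) (inp out rows used prev : List Letter)
    (row : Fin 3 → List Letter) : TM2.Cfg (fun _ : Stack => Letter) Label Reg :=
  ⟨l, (flag, none, none), contents inp out rows used prev row⟩

/-- `a` leads to `b` in at most `t` steps of the program. -/
abbrev Runs (a b : TM2.Cfg (fun _ : Stack => Letter) Label Reg) (t : ℕ) : Prop :=
  ReachesWithin (TM2.step program) a b t

/-! ### Description of the written rows as lists -/

/-- The bits of a row of a matrix, with the mark for column `i`. -/
def markColumn (i : ℕ) (r : List Bool) : List (Bool × Bool) :=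
  r.mapIdx fun k b => (decide (k = i), b)

/-- The bit in the second column of a vertex, for the three kinds of items. -/
def secondBit : Fin 3 → Bool × Bool → Bool
  | 0, _ => false
  | 1, p => p.1
  | 2, p => p.2

/-- The two columns of each vertex in the rows of the three kinds. -/
def pairColumns (t : Fin 3) (ps : List (Bool × Bool)) : List Bool :=
  ps.flatMap fun p => [p.1, secondBit t p]

theorem markColumn_cons_zero (b : Bool) (r : List Bool) :
    markColumn 0 (b :: r) = (true, b) :: r.map (Prod.mk false) := by
  refine List.ext_getElem (by simp [markColumn]) fun k _ _ => ?_
  cases k <;> simp [markColumn]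

theorem markColumn_cons_succ (i : ℕ) (b : Bool) (r : List Bool) :
    markColumn (i + 1) (b :: r) = (false, b) :: markColumn i r := by
  simp [markColumn, List.mapIdx_cons]

theorem pairColumns_cons (t : Fin 3) (p : Bool × Bool) (ps : List (Bool × Bool)) :
    pairColumns t (p :: ps) = p.1 :: secondBit t p :: pairColumns t ps := by
  simp [pairColumns]

theorem pairColumns_length (t : Fin 3) (ps : List (Bool × Bool)) :
    (pairColumns t ps).length = 2 * ps.length := by
  induction ps with
  | nil => rfl
  | cons p ps ih => rw [pairColumns_cons, List.length_cons, List.length_cons, ih,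
      List.length_cons]; ring

theorem markColumn_length (i : ℕ) (r : List Bool) : (markColumn i r).length = r.length := by
  simp [markColumn]

/-! ### Processing one row of an adjacency matrix -/

theorem runs_bit_marked (b flag : Bool) (i : ℕ) (inp out used prev : List Letter)
    (row : Fin 3 → List Letter) :
    Runs (config (some .read) flag (bitLetter b :: inp) out (List.replicate (i + 1) .one) used prev row)
      (config (some .read) flag inp out (List.replicate i .one) (.one :: used) prev
        (fun t => ((pairColumns t [(false, b)]).map bitLetter).reverse ++ row t)) 1 := by
  apply ReachesWithin.single
  have : (fun t => ((pairColumns t [(false, b)]).map bitLetter).reverse ++ row t) =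
      update (update (update row 0 (.zero :: .zero :: row 0)) 1 (.zero :: .zero :: row 1)) 2
        (bitLetter b :: .zero :: row 2) := by
    funext t
    fin_cases t <;> simp [pairColumns, secondBit, bitLetter]
  rw [this]
  cases b <;> simp [config, program, bitLetter, diagLetter, List.replicate_succ]

/-- With the counter empty, the flag separates the diagonal entry (flag still false) from the
entries after it. -/
theorem runs_bit_diag (b flag : Bool) (inp out used prev : List Letter)
    (row : Fin 3 → List Letter) :
    Runs (config (some .read) flag (bitLetter b :: inp) out [] used prev row)
      (config (some .read) true inp out [] used prev
        (fun t => ((pairColumns t [(!flag, b)]).map bitLetter).reverse ++ row t)) 1 := by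
  apply ReachesWithin.single
  have : (fun t => ((pairColumns t [(!flag, b)]).map bitLetter).reverse ++ row t) =
      update (update (update row 0 (.zero :: bitLetter (!flag) :: row 0)) 1
        (bitLetter (!flag) :: bitLetter (!flag) :: row 1)) 2
        (bitLetter b :: bitLetter (!flag) :: row 2) := by
    funext t
    fin_cases t <;> simp [pairColumns, secondBit, bitLetter]
  rw [this]
  cases b <;> simp [config, program, bitLetter, diagLetter]

theorem runs_bits_after (r : List Bool) (inp out used prev : List Letter)
    (row : Fin 3 → List Letter) :
    Runs (config (some .read) true (r.map bitLetter ++ inp) out [] used prev row)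
      (config (some .read) true inp out [] used prev
        (fun t => ((pairColumns t (r.map (Prod.mk false))).map bitLetter).reverse ++ row t))
      r.length := by
  induction r generalizing row with
  | nil => exact ReachesWithin.refl _ _
  | cons b r ih =>
    rw [List.length_cons, add_comm]
    refine (runs_bit_diag b true _ _ _ _ row).trans ?_
    convert ih _ using 2 <;> simp [pairColumns]

/-- The bound on `i` ensures that the diagonal is met, so the flag ends up true; the counter is
saved in `used` for the next row. -/
theorem runs_bits (r : List Bool) (i : ℕ) (hi : i < r.length) (inp out used prev : List Letter)
    (row : Fin 3 → List Letter) :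
    Runs (config (some .read) false (r.map bitLetter ++ inp) out (List.replicate i .one) used prev row)
      (config (some .read) true inp out [] (List.replicate i .one ++ used) prev
        (fun t => ((pairColumns t (markColumn i r)).map bitLetter).reverse ++ row t))
      r.length := by
  induction r generalizing row i used with
  | nil => simp at hi
  | cons b r ih =>
    rw [List.length_cons, add_comm]
    cases i with
    | zero =>
      refine (runs_bit_diag b false _ _ _ _ row).trans ?_
      convert runs_bits_after r _ _ _ _ _ using 2 <;> simp [pairColumns, markColumn_cons_zero]
    | succ i =>
      refine (runs_bit_marked b false i _ _ _ _ row).trans ?_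
      convert ih i (by simpa using hi) _ _ using 2 <;>
        simp [pairColumns, markColumn_cons_succ, List.replicate_succ']

/-- The columns were pushed in reading order, so moving them to another stack restores that order
from the top. -/
theorem runs_drain (t : Fin 3) (flag : Bool) (inp out rows used prev : List Letter)
    (row : Fin 3 → List Letter) :
    Runs (config (some (.drain t)) flag inp out rows used prev row)
      (config (some (Label.afterDrain t)) flag inp ((row t).reverse ++ out) rows used prev
        (update row t [])) ((row t).length + 1) := by
  generalize h : row t = x
  induction x generalizing out row with
  | nil => exact ReachesWithin.single (by simp [config, program, h])
  | cons a x ih =>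
    refine ReachesWithin.head
      (b := config (some (.drain t)) flag inp (a :: out) rows used prev (update row t x))
      (by simp [config, program, h]) ?_
    simpa using ih (a :: out) (update row t x) (by simp)

theorem runs_rowStart (t : Fin 3) (flag : Bool) (inp out rows used prev : List Letter)
    (row : Fin 3 → List Letter) :
    Runs (config (some (.rowStart t)) flag inp out rows used prev row)
      (config (some (Label.afterDrain t)) flag inp
        ((row t).reverse ++ ([decide (t = 2), decide (t = 2)].map bitLetter ++ .rowEnd :: out))
        rows used prev (update row t [])) ((row t).length + 2) :=
  ReachesWithin.head (b := config (some (.drain t)) flag inp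
    ([decide (t = 2), decide (t = 2)].map bitLetter ++ .rowEnd :: out) rows used prev row)
    (by simp [config, program]) (runs_drain _ _ _ _ _ _ _ _)

theorem runs_back (flag : Bool) (a b : ℕ) (inp out prev : List Letter)
    (row : Fin 3 → List Letter) :
    Runs (config (some .back) flag inp out (List.replicate a .one) (List.replicate b .one) prev row)
      (config (some .read) flag inp out (List.replicate (a + b) .one) [] prev row) (b + 1) := by
  induction b generalizing a with
  | zero => exact ReachesWithin.single (by simp [config, program])
  | succ b ih =>
    refine ReachesWithin.head (b := config (some .back) flag inp out (List.replicate (a + 1) .one)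
      (List.replicate b .one) prev row) (by simp [config, program, List.replicate_succ]) ?_
    convert ih (a + 1) using 3
    ring

theorem runs_shift (flag : Bool) (a b : ℕ) (inp out : List Letter)
    (row : Fin 3 → List Letter) :
    Runs (config (some .shift) flag inp out (List.replicate b .one) [] (List.replicate a .one) row)
      (config (some .read) flag inp out [] [] (List.replicate (a + b) .one) row) (b + 1) := by
  induction b generalizing a with
  | zero => exact ReachesWithin.single (by simp [config, program])
  | succ b ih =>
    refine ReachesWithin.head (b := config (some .shift) flag inp out (List.replicate b .one)
      [] (List.replicate (a + 1) .one) row) (by simp [config, program, List.replicate_succ]) ?_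
    convert ih (a + 1) using 3
    ring

/-- A row of a matrix of bits as it is written down. -/
def encodeRow (r : List Bool) : List Letter := r.map bitLetter ++ [Letter.rowEnd]

/-- The rows of the three items of vertex `i`, computed from row `i` of the adjacency matrix. -/
def itemRow (r : List Bool) (i : ℕ) (t : Fin 3) : List Bool :=
  pairColumns t (markColumn i r) ++ [decide (t = 2), decide (t = 2)]

/-- The rows of the items of all vertices, in the order in which they are written. -/
def itemRows (i : ℕ) (L : List (List Bool)) : List (List Bool) :=
  (L.zipIdx i).flatMap fun p => (List.finRange 3).map (itemRow p.1 p.2)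

theorem itemRows_cons (i : ℕ) (r : List Bool) (L : List (List Bool)) :
    itemRows i (r :: L) = itemRow r i 0 :: itemRow r i 1 :: itemRow r i 2 :: itemRows (i + 1) L := by
  simp [itemRows, List.finRange_succ]

theorem runs_row (r : List Bool) (i : ℕ) (hi : i < r.length) (inp out prev : List Letter) :
    Runs (config (some .read) false (encodeRow r ++ inp) out (List.replicate i .one) [] prev
        fun _ => [])
      (config (some .read) false inp
        (encodeRow (itemRow r i 2) ++ (encodeRow (itemRow r i 1) ++
          (encodeRow (itemRow r i 0) ++ out)))
        (List.replicate (i + 1) .one) [] prev fun _ => []) (8 * r.length + 8) := by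
  have h₁ := runs_bits r i hi (.rowEnd :: inp) out [] prev fun _ => []
  set w : Fin 3 → List Letter :=
    fun t => ((pairColumns t (markColumn i r)).map bitLetter).reverse with hw
  have hl : ∀ t, (w t).length = 2 * r.length := by
    intro t
    simp [hw, pairColumns_length, markColumn_length]
  have h₂ : Runs
      (config (some .read) true (.rowEnd :: inp) out [] (List.replicate i .one) prev w)
      (config (some (.rowStart 0)) false inp out [.one] (List.replicate i .one) prev w) 1 :=
    ReachesWithin.single (by simp [config, program])
  have h₃ := runs_rowStart 0 false inp out [.one] (List.replicate i .one) prev w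
  have h₄ := h₃.trans (runs_rowStart 1 false _ _ _ _ _ _)
  have h₅ := h₄.trans (runs_rowStart 2 false _ _ _ _ _ _)
  have h₆ := runs_back false 1 i inp (encodeRow (itemRow r i 2) ++ (encodeRow (itemRow r i 1) ++
          (encodeRow (itemRow r i 0) ++ out))) prev fun _ => []
  have hw' : update (update (update w 0 []) 1 []) 2 [] = fun _ => [] := by
    funext t
    fin_cases t <;> simp
  rw [hw'] at h₅
  simp only [ne_eq, Fin.reduceEq, not_false_eq_true, update_of_ne, hl] at h₅
  have h₇ : Runs (config (some (.rowStart 0)) false inp out [.one] (List.replicate i .one) prev w)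
      (config (some .back) false inp (encodeRow (itemRow r i 2) ++ (encodeRow (itemRow r i 1) ++
          (encodeRow (itemRow r i 0) ++ out))) (List.replicate 1 .one) (List.replicate i .one)
          prev fun _ => []) (6 * r.length + 6) := by
    convert h₅.mono (t := 6 * r.length + 6) (by omega) using 2
    · rfl
    · simp [hw, encodeRow, itemRow]
    · rfl
  have h₈ := h₂.trans (h₇.trans h₆)
  rw [add_comm 1 i] at h₈
  have h₉ : Runs (config (some .read) false (encodeRow r ++ inp) out (List.replicate i .one) [] prev
        fun _ => []) (config (some .read) true (.rowEnd :: inp) out [] (List.replicate i .one) prev w)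
        r.length := by
    simpa [encodeRow] using h₁
  -- The steps are `r.length` for the bits, 1 for the row mark, three times `2 * r.length + 2` for
  -- the output and `i + 1` for restoring the counter, with `i < r.length`.
  exact (h₉.trans h₈).mono (by omega)

theorem runs_rows (n : ℕ) (L : List (List Bool)) (hn : ∀ r ∈ L, r.length = n) (i : ℕ)
    (hi : i + L.length ≤ n) (inp out prev : List Letter) :
    Runs (config (some .read) false (L.flatMap encodeRow ++ inp) out (List.replicate i .one) []
        prev fun _ => [])
      (config (some .read) false inp ((itemRows i L).reverse.flatMap encodeRow ++ out)
        (List.replicate (i + L.length) .one) [] prev fun _ => []) (L.length * (8 * n + 8)) := by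
  induction L generalizing i out with
  | nil => exact ReachesWithin.refl _ _
  | cons r L ih =>
    rw [List.length_cons] at hi
    have hr : r.length = n := hn r List.mem_cons_self
    have h₁ := runs_row r i (by omega) (L.flatMap encodeRow ++ inp) out prev
    have h₂ := ih (fun r' h => hn r' (List.mem_cons_of_mem _ h)) (i + 1) (by omega)
      (encodeRow (itemRow r i 2) ++ (encodeRow (itemRow r i 1) ++
          (encodeRow (itemRow r i 0) ++ out)))
    convert h₁.trans h₂ using 2
    · simp
    · simp [itemRows_cons]
    · rw [List.length_cons, add_assoc, add_comm 1]
    · rw [List.length_cons, hr]; ring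

/-! ### Comparing the orders of the graphs -/

/-- Each of the `n` matching pairs yields two ones, and the final step, with both counters empty,
yields the two for the extra columns. -/
theorem runs_compare_eq (n : ℕ) (out : List Letter) :
    Runs (config (some .compare) false [] out (List.replicate n .one) [] (List.replicate n .one)
        fun _ => [])
      (config none false [] (List.replicate (n * 2 + 2) .one ++ out) [] [] [] fun _ => [])
      (n + 1) := by
  induction n generalizing out with
  | zero => exact ReachesWithin.single (by simp [config, program, List.replicate_succ])
  | succ n ih =>
    refine ReachesWithin.head (b := config (some .compare) false [] (.one :: .one :: out)
      (List.replicate n .one) [] (List.replicate n .one) fun _ => [])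
      (by simp [config, program, List.replicate_succ]) ?_
    convert ih (.one :: .one :: out) using 2
    rw [show (n + 1) * 2 + 2 = n * 2 + 2 + 1 + 1 by ring, List.replicate_succ',
      List.replicate_succ']
    simp

/-- All three stacks are popped in the same step, so the greatest height bounds the time; one more
step detects emptiness and writes the no-instance. -/
theorem runs_clear (k : ℕ) (out rows prev : List Letter) (ho : out.length ≤ k)
    (hr : rows.length ≤ k) (hp : prev.length ≤ k) :
    Runs (config (some .clear) false [] out rows [] prev fun _ => [])
      (config none false [] [.blockEnd, .rowEnd, .blockEnd, .blockEnd] [] [] [] fun _ => [])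
      (k + 1) := by
  induction k generalizing out rows prev with
  | zero =>
    obtain rfl := List.length_eq_zero_iff.1 (Nat.le_zero.1 ho)
    obtain rfl := List.length_eq_zero_iff.1 (Nat.le_zero.1 hr)
    obtain rfl := List.length_eq_zero_iff.1 (Nat.le_zero.1 hp)
    exact ReachesWithin.single (by simp [config, program])
  | succ k ih =>
    by_cases h : out = [] ∧ rows = [] ∧ prev = []
    · obtain ⟨rfl, rfl, rfl⟩ := h
      exact (ih [] [] [] (by simp) (by simp) (by simp)).mono (Nat.le_succ _)
    · refine ReachesWithin.head (b := config (some .clear) false [] out.tail rows.tail [] prev.tail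
        fun _ => []) ?_ (ih _ _ _ (by simp; omega) (by simp; omega) (by simp; omega))
      cases out <;> cases rows <;> cases prev <;> simp_all [config, program]

/-- Ones are written before the mismatch is found. `out.length + 2 * m` is unchanged by a matching
round, so it bounds the output still to be erased. -/
theorem runs_compare_ne (m n k : ℕ) (hmn : m ≠ n) (out : List Letter) (hm : m ≤ k) (hn : n ≤ k)
    (ho : out.length + 2 * m ≤ k) :
    Runs (config (some .compare) false [] out (List.replicate m .one) [] (List.replicate n .one)
        fun _ => [])
      (config none false [] [.blockEnd, .rowEnd, .blockEnd, .blockEnd] [] [] [] fun _ => [])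
      (m + k + 2) := by
  induction m generalizing out n with
  | zero =>
    cases n with
    | zero => exact (hmn rfl).elim
    | succ n =>
      refine (ReachesWithin.head (b := config (some .clear) false [] out [] []
        (List.replicate n .one) fun _ => [])
        (by simp [config, program, List.replicate_succ])
        (runs_clear k _ _ _ (by omega) (by simp) (by simp; omega))).mono (by omega)
  | succ m ih =>
    cases n with
    | zero =>
      refine (ReachesWithin.head (b := config (some .clear) false [] out
        (List.replicate m .one) [] [] fun _ => [])
        (by simp [config, program, List.replicate_succ])
        (runs_clear k _ _ _ (by omega) (by simp; omega) (by simp))).mono (by omega)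
    | succ n =>
      refine (ReachesWithin.head (b := config (some .compare) false [] (.one :: .one :: out)
        (List.replicate m .one) [] (List.replicate n .one) fun _ => [])
        (by simp [config, program, List.replicate_succ])
        (ih n (by omega) _ (by omega) (by omega) (by simp; omega))).mono (by omega)

open StateTransition

theorem encodeMatrix_eq (L : List (List Bool)) :
    encodeMatrix L = L.flatMap encodeRow ++ [Letter.blockEnd] := rfl

/-- The machine reads two adjacency matrices and writes the two itemsets. -/
theorem runs_start (m n : ℕ) (L M : List (List Bool)) (hL : L.length = m)
    (hLr : ∀ r ∈ L, r.length = m) (hM : M.length = n) (hMr : ∀ r ∈ M, r.length = n) :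
    Runs (config (some .start) false (encodeMatrix L ++ encodeMatrix M) [] [] [] [] fun _ => [])
      (config (some .compare) false [] (.blockEnd :: (encodeMatrix (itemRows 0 M).reverse ++
        encodeMatrix (itemRows 0 L).reverse)) (List.replicate n .one) [] (List.replicate m .one)
        fun _ => []) (m * (8 * m + 8) + n * (8 * n + 8) + m + 4) := by
  have h₁ : Runs
      (config (some .start) false (encodeMatrix L ++ encodeMatrix M) [] [] [] [] fun _ => [])
      (config (some .read) false (L.flatMap encodeRow ++ (.blockEnd :: encodeMatrix M))
        [.blockEnd] (List.replicate 0 .one) [] [] fun _ => []) 1 :=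
    ReachesWithin.single (by simp [config, program, encodeMatrix_eq])
  have h₂ := runs_rows m L hLr 0 (by omega) (.blockEnd :: encodeMatrix M) [.blockEnd] []
  rw [zero_add, hL, ← encodeMatrix_eq] at h₂
  have h₃ : Runs (config (some .read) false (.blockEnd :: encodeMatrix M)
        (encodeMatrix (itemRows 0 L).reverse) (List.replicate m .one) [] [] fun _ => [])
      (config (some .shift) false (encodeMatrix M)
        (.blockEnd :: encodeMatrix (itemRows 0 L).reverse) (List.replicate m .one) []
        (List.replicate 0 .one) fun _ => []) 1 := by
    refine ReachesWithin.single ?_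
    -- Even an empty matrix is written with its closing mark, so peeking tells the first block from
    -- the second.
    obtain ⟨a, u, hau⟩ : ∃ a u, encodeMatrix M = a :: u :=
      List.exists_cons_of_ne_nil (by simp [encodeMatrix])
    simp [config, program, hau]
  have h₄ := runs_shift false 0 m (encodeMatrix M)
    (.blockEnd :: encodeMatrix (itemRows 0 L).reverse) fun _ => []
  have h₅ := runs_rows n M hMr 0 (by omega) [.blockEnd]
    (.blockEnd :: encodeMatrix (itemRows 0 L).reverse) (List.replicate (0 + m) .one)
  rw [zero_add, zero_add, hM, ← encodeMatrix_eq] at h₅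
  rw [zero_add] at h₄
  have h₆ : Runs (config (some .read) false [.blockEnd] ((itemRows 0 M).reverse.flatMap encodeRow ++
        .blockEnd :: encodeMatrix (itemRows 0 L).reverse) (List.replicate n .one) []
        (List.replicate m .one) fun _ => [])
      (config (some .compare) false [] (.blockEnd :: (encodeMatrix (itemRows 0 M).reverse ++
        encodeMatrix (itemRows 0 L).reverse)) (List.replicate n .one) [] (List.replicate m .one)
        fun _ => []) 1 :=
    ReachesWithin.single (by simp [config, program, encodeMatrix_eq])
  exact (h₁.trans (h₂.trans (h₃.trans (h₄.trans (h₅.trans h₆))))).mono (by omega)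

/-! ### Lengths of the words, and agreement of the written rows with the items -/

theorem encodeMatrix_length (n : ℕ) (L : List (List Bool)) (hn : ∀ r ∈ L, r.length = n) :
    (encodeMatrix L).length = L.length * (n + 1) + 1 := by
  induction L with
  | nil => simp [encodeMatrix]
  | cons r L ih =>
    have := ih fun r' h => hn r' (List.mem_cons_of_mem _ h)
    rw [← List.append_nil (encodeMatrix (r :: L)), encodeMatrix_cons]
    simp only [List.append_nil, List.length_append, List.length_map, List.length_cons, this,
      hn r List.mem_cons_self]
    ring

theorem itemRow_length (r : List Bool) (i : ℕ) (t : Fin 3) :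
    (itemRow r i t).length = 2 * r.length + 2 := by
  simp [itemRow, pairColumns_length, markColumn_length]

theorem itemRows_length (i : ℕ) (L : List (List Bool)) : (itemRows i L).length = L.length * 3 := by
  induction L generalizing i with
  | nil => rfl
  | cons r L ih =>
    simp only [itemRows_cons, List.length_cons, ih]
    ring

theorem encodeMatrix_itemRows_length (n : ℕ) (L : List (List Bool)) (hL : L.length = n)
    (hn : ∀ r ∈ L, r.length = n) :
    (encodeMatrix (itemRows 0 L).reverse).length = n * 3 * (2 * n + 2 + 1) + 1 := by
  rw [encodeMatrix_length (2 * n + 2), List.length_reverse, itemRows_length, hL]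
  intro r hr
  obtain ⟨p, hp, hr⟩ := List.mem_flatMap.1 (List.mem_reverse.1 hr)
  obtain ⟨t, -, rfl⟩ := List.mem_map.1 hr
  rw [itemRow_length, hn p.1 (List.fst_mem_of_mem_zipIdx hp)]

theorem length_of_mem_adjacencyRows {n : ℕ} (G : SimpleGraph (Fin n)) :
    ∀ r ∈ adjacencyRows G, r.length = n := by
  intro r hr
  obtain ⟨i, rfl⟩ := (List.mem_ofFn' _ _).1 hr
  simp

open Classical in
theorem ofFn_mem_vertexItem {n : ℕ} (G : SimpleGraph (Fin n)) (i : Fin n) (t : Fin 3) :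
    (List.ofFn fun d => decide (d ∈ vertexItem G i t)) =
      itemRow (List.ofFn fun j => decide (G.Adj i j)) i t := by
  rw [vertexItem, ofFn_mem_columnItem, itemRow, pairColumns]
  congr 1
  rw [List.flatMap_def]
  congr 1
  refine List.ext_getElem (by simp [markColumn]) fun k _ _ => ?_
  fin_cases t <;> simp [markColumn, secondBit, Fin.ext_iff]

theorem vertexListing_matrixRows {n : ℕ} (G : SimpleGraph (Fin n)) :
    (vertexListing G).matrixRows = (itemRows 0 (adjacencyRows G)).reverse := by
  classical
  have h : (adjacencyRows G).zipIdx 0 =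
      (List.finRange n).map fun i => (List.ofFn fun j => decide (G.Adj i j), i.val) := by
    refine List.ext_getElem (by simp [adjacencyRows]) fun k _ _ => ?_
    simp [adjacencyRows]
  simp only [ItemsetListing.matrixRows, vertexListing, itemRows, h, List.map_reverse,
    List.map_flatMap, List.flatMap_map, List.map_map]
  congr 2
  funext i
  refine List.map_congr_left fun t _ => ?_
  simp only [comp_apply, ← ofFn_mem_vertexItem]

/-! ### The complete machine and its time bound -/

/-- The machine that computes the reduction. -/
def machine : FinTM2 where
  K := Stack
  k₀ := .inp
  k₁ := .out
  Γ _ := Letter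
  Λ := Label
  main := .start
  σ := Reg
  initialState := (false, none, none)
  m := program

theorem initList_machine (s : List Letter) :
    initList machine s = config (some .start) false s [] [] [] [] fun _ => [] := by
  have : (initList machine s).stk = contents s [] [] [] [] fun _ => [] := by
    funext k
    cases k <;> rfl
  exact congrArg (TM2.Cfg.mk (some Label.start) ((false, none, none) : Reg)) this

theorem haltList_machine (s : List Letter) :
    haltList machine s = config none false [] s [] [] [] fun _ => [] := by
  have : (haltList machine s).stk = contents [] s [] [] [] fun _ => [] := by
    funext k
    cases k <;> rfl
  exact congrArg (TM2.Cfg.mk none ((false, none, none) : Reg)) this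

theorem GIInstance_encode_length (x : GIInstance) :
    x.encode.length = x.m * (x.m + 1) + x.n * (x.n + 1) + 2 := by
  rw [GIInstance.encode, List.length_append,
    encodeMatrix_length _ _ (length_of_mem_adjacencyRows x.G),
    encodeMatrix_length _ _ (length_of_mem_adjacencyRows x.H), adjacencyRows_length,
    adjacencyRows_length]
  ring

theorem runs_machine (x : GIInstance) :
    Runs (config (some .start) false x.encode [] [] [] [] fun _ => [])
      (config none false [] (graphToItemsets x).encode [] [] [] fun _ => [])
      (40 * x.encode.length) := by
  rw [GIInstance_encode_length]
  obtain ⟨m, n, G, H⟩ := x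
  have h := runs_start m n _ _ (adjacencyRows_length G) (length_of_mem_adjacencyRows G)
    (adjacencyRows_length H) (length_of_mem_adjacencyRows H)
  by_cases hnm : n = m
  · subst hnm
    have h' := h.trans (runs_compare_eq n _)
    rw [← vertexListing_matrixRows, ← vertexListing_matrixRows] at h'
    have he : (graphToItemsets ⟨n, n, G, H⟩).encode =
        List.replicate (n * 2 + 2) .one ++ .blockEnd :: (encodeMatrix (vertexListing H).matrixRows ++
          encodeMatrix (vertexListing G).matrixRows) := by
      have hf : graphToItemsets ⟨n, n, G, H⟩ = ⟨n * 2 + 2, vertexListing H, vertexListing G⟩ :=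
        dif_pos rfl
      rw [hf]
      simp [SIInstance.encode, encodeUnary]
    rw [he]
    exact h'.mono (by dsimp only; nlinarith)
  · have he : (graphToItemsets ⟨m, n, G, H⟩).encode =
        [.blockEnd, .rowEnd, .blockEnd, .blockEnd] := by
      simp only [graphToItemsets, dif_neg hnm]
      rfl
    rw [he]
    -- The constant is the height of the output stack plus `2 * n` for the ones pushed while
    -- comparing, plus `m` so that it also bounds the other counter.
    refine (h.trans (runs_compare_ne n m
      (n * 3 * (2 * n + 2 + 1) + m * 3 * (2 * m + 2 + 1) + 2 * n + m + 3) hnm _ (by omega)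
      (by omega) ?_)).mono (by dsimp only; nlinarith)
    rw [List.length_cons, List.length_append,
      encodeMatrix_itemRows_length n _ (adjacencyRows_length H) (length_of_mem_adjacencyRows H),
      encodeMatrix_itemRows_length m _ (adjacencyRows_length G) (length_of_mem_adjacencyRows G)]
    omega

theorem graphToItemsets_polyTimeComputable :
    PolyTimeComputable graphIsomorphism subitemsetIsomorphism graphToItemsets := by
  -- `u` and `v` stand for the encodings mapped along the identity of the alphabet. `Nonempty` is
  -- used since the run is required as data while only its existence has been shown.
  have h (x : GIInstance) (u v : List Letter) (hu : u = x.encode)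
      (hv : v = (graphToItemsets x).encode) :
      Nonempty (EvalsToInTime (TM2.step program) (initList machine u) (some (haltList machine v))
        ((40 * Polynomial.X : Polynomial ℕ).eval x.encode.length)) := by
    obtain ⟨k, hk, hr⟩ := runs_machine x
    refine ⟨⟨k, ?_⟩, by simpa using hk⟩
    rw [initList_machine, haltList_machine, hu, hv]
    exact hr
  exact ⟨{
    tm := machine
    inputAlphabet := Equiv.refl Letter
    outputAlphabet := Equiv.refl Letter
    time := 40 * Polynomial.X
    outputsFun := fun x => Classical.choice (h x _ _ (List.map_id _) (List.map_id _)) },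
    fun _ => inferInstanceAs (Finite Letter)⟩

end ItemsetMachine

theorem mainTheorem2 : GIHard subitemsetIsomorphism :=
  ⟨graphToItemsets, ItemsetMachine.graphToItemsets_polyTimeComputable, graphToItemsets_yes_iff⟩
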